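/- Let $d\ge 1$, $\alpha\in(0,2)$, let $D\subseteq\mathbf R^d$ be a bounded open set, and let $\varepsilon>0$. Put $c_{d,\alpha}=2^\alpha\,\Gamma(\tfrac{d+\alpha}{2})/(\pi^{d/2}\,|\Gamma(-\tfrac{\alpha}{2})|)$. Let $\mathcal A_D$ be the fractional Laplace operator $(-\Delta)^{\alpha/2}$ in $D$ with zero exterior condition, that is, the self-adjoint operator on $L^2(D)$ associated with the Dirichlet form $$\mathcal E(f,g)=\frac{c_{d,\alpha}}2\int_{\mathbf R^d}\int_{\mathbf R^d}\frac{(f(x)-f(y))(g(x)-g(y))}{|x-y|^{d+\alpha}}\,dx\,dy,$$ where functions on $D$ are extended by zero to $\mathbf R^d$ and the form domain is the closure of $C_c^\infty(D)$ in the norm $(\|f\|_2^2+\mathcal E(f,f))^{1/2}$. Let $\lambda_1\le\lambda_2\le\cdots$ be the eigenvalues of $\mathcal A_D$, counted with multiplicity. Let $K_\varepsilon$ be the (finite) set of those $k\in\mathbf Z^d$ for which $D\cap\prod_{j=1}^d[k_j\varepsilon,(k_j+1)\varepsilon]$ is nonempty, let $N=|K_\varepsilon|$, and let $\kappa:\{1,\dots,N\}\to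 K_\varepsilon$ be any enumeration (bijection). Let $$\bar\nu=\sum_{k\in\mathbf Z^d}\|k\|^{-d-\alpha},\qquad\text{where}\quad \|k\|=\Bigl(\sum_{j=1}^d(|k_j|+1)^2\Bigr)^{1/2}.$$ Define the $N\times N$ real symmetric matrix $V$ by $$V_{p,q}=-\frac{c_{d,\alpha}}{\varepsilon^{\alpha}}\,\|\kappa(p)-\kappa(q)\|^{-d-\alpha}\quad(p\ne q),\qquad V_{p,p}=\frac{c_{d,\alpha}}{\varepsilon^{\alpha}}\bigl(\bar\nu-d^{-(d+\alpha)/2}\bigr).$$ For $n\ge1$, let $\lambda_{n,\varepsilon}$ be the $n$-th smallest eigenvalue of $V$ (counted with multiplicity) if $n\le N$ and this eigenvalue does not exceed $c_{d,\alpha}\varepsilon^{-\alpha}\bar\nu$, and let $\lambda_{n,\varepsilon}=c_{d,\alpha}\varepsilon^{-\alpha}\bar\nu$ otherwise. Then the eigenvalues of $\mathcal A_D$ satisfy $\lambda_n\ge\lambda_{n,\varepsilon}$ for every $n\ge1$. -/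

import Mathlib

open MeasureTheory
open scoped ENNReal

noncomputable section

namespace FracLap

/-- The constant `c_{d,α} = 2^α Γ((d+α)/2) / (π^{d/2} |Γ(-α/2)|)`. -/
def fracConst (d : ℕ) (α : ℝ) : ℝ :=
  2 ^ α * Real.Gamma (((d : ℝ) + α) / 2) / (Real.pi ^ ((d : ℝ) / 2) * |Real.Gamma (-α / 2)|)

/-- The Dirichlet form of `(-Δ)^{α/2}`:
`E(f, g) = (c_{d,α} / 2) ∬ (f x - f y) (g x - g y) / |x - y|^{d+α} dx dy`.
It is used for functions of finite energy only, for which the integrand is integrable. -/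
def dirichletForm {d : ℕ} (α : ℝ) (f g : EuclideanSpace ℝ (Fin d) → ℝ) : ℝ :=
  fracConst d α / 2 * ∫ z : EuclideanSpace ℝ (Fin d) × EuclideanSpace ℝ (Fin d),
    (f z.1 - f z.2) * (g z.1 - g z.2) / ‖z.1 - z.2‖ ^ ((d : ℝ) + α)

/-- The energy `E(f, f)`, with values in `[0, ∞]`. -/
def energy {d : ℕ} (α : ℝ) (f : EuclideanSpace ℝ (Fin d) → ℝ) : ℝ≥0∞ :=
  ENNReal.ofReal (fracConst d α / 2) *
    ∫⁻ z : EuclideanSpace ℝ (Fin d) × EuclideanSpace ℝ (Fin d),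
      ENNReal.ofReal ((f z.1 - f z.2) ^ 2 / ‖z.1 - z.2‖ ^ ((d : ℝ) + α))

/-- The real Hilbert space `L²(D)`. -/
abbrev L2 {d : ℕ} (D : Set (EuclideanSpace ℝ (Fin d))) : Type :=
  Lp ℝ 2 (volume.restrict D)

/-- The extension of `u ∈ L²(D)` by zero to the whole space. -/
def zeroExt {d : ℕ} {D : Set (EuclideanSpace ℝ (Fin d))} (u : L2 D) :
    EuclideanSpace ℝ (Fin d) → ℝ :=
  D.indicator u

/-- The space `C_c^∞(D)` of test functions on `D`. -/
def IsTestFunction {d : ℕ} (D : Set (EuclideanSpace ℝ (Fin d)))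
    (φ : EuclideanSpace ℝ (Fin d) → ℝ) : Prop :=
  ContDiff ℝ (⊤ : ℕ∞) φ ∧ HasCompactSupport φ ∧ tsupport φ ⊆ D

/-- The form domain: the closure of `C_c^∞(D)`, in the norm `(‖u‖₂² + E(u, u))^{1/2}`, in the space
of those `u ∈ L²(D)` that have finite energy. -/
def formDomain {d : ℕ} (α : ℝ) (D : Set (EuclideanSpace ℝ (Fin d))) : Set (L2 D) :=
  {u | energy α (zeroExt u) < ∞ ∧
    ∀ δ : ℝ≥0∞, 0 < δ → ∃ φ : EuclideanSpace ℝ (Fin d) → ℝ, IsTestFunction D φ ∧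
      eLpNorm (zeroExt u - φ) 2 volume < δ ∧ energy α (zeroExt u - φ) < δ}

/-- `IsFracLaplacian α D u g` says that `u` lies in the domain of the operator `A_D` and
`A_D u = g`. Here `A_D` is the fractional Laplace operator `(-Δ)^{α/2}` in `D` with zero exterior
condition, that is, the self-adjoint operator on `L²(D)` associated with the closed form `E` on
`formDomain α D` (the Friedrichs extension from `C_c^∞(D)`). -/
def IsFracLaplacian {d : ℕ} (α : ℝ) (D : Set (EuclideanSpace ℝ (Fin d))) (u g : L2 D) : Prop :=
  u ∈ formDomain α D ∧
    ∀ v ∈ formDomain α D, dirichletForm α (zeroExt u) (zeroExt v) = inner ℝ g v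

/-- The span of all eigenfunctions of `A_D` whose eigenvalue lies in the set `S`. Its dimension is
the number of eigenvalues in `S`, counted with multiplicity. -/
def eigenSpan {d : ℕ} (α : ℝ) (D : Set (EuclideanSpace ℝ (Fin d))) (S : Set ℝ) :
    Submodule ℝ (L2 D) :=
  Submodule.span ℝ {u | ∃ μ ∈ S, IsFracLaplacian α D u (μ • u)}

/-- `lam` is the `n`-th smallest eigenvalue of `A_D`, counted with multiplicity (`n = 1, 2, …`):
fewer than `n` eigenvalues are smaller than `lam`, at least `n` eigenvalues are `≤ lam`. -/
def IsNthEigenvalue {d : ℕ} (α : ℝ) (D : Set (EuclideanSpace ℝ (Fin d))) (n : ℕ) (lam : ℝ) :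
    Prop :=
  Module.rank ℝ (eigenSpan α D (Set.Iio lam)) < n ∧
    (n : Cardinal) ≤ Module.rank ℝ (eigenSpan α D (Set.Iic lam))

/-- The closed cube `I_k = ∏_j [k_j ε, (k_j + 1) ε]`. -/
def gridCube {d : ℕ} (ε : ℝ) (k : Fin d → ℤ) : Set (EuclideanSpace ℝ (Fin d)) :=
  {x | ∀ j, (k j : ℝ) * ε ≤ x j ∧ x j ≤ ((k j : ℝ) + 1) * ε}

/-- The set `K_ε` of those `k ∈ ℤ^d` for which `I_k` meets `D`. -/
def gridIndex {d : ℕ} (D : Set (EuclideanSpace ℝ (Fin d))) (ε : ℝ) : Set (Fin d → ℤ) :=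
  {k | (D ∩ gridCube ε k).Nonempty}

/-- `‖k‖ = (∑_j (|k_j| + 1)²)^{1/2}` for `k ∈ ℤ^d`. -/
def gridNorm {d : ℕ} (k : Fin d → ℤ) : ℝ :=
  Real.sqrt (∑ j, (|(k j : ℝ)| + 1) ^ 2)

/-- `ν̄ = ∑_{k ∈ ℤ^d} ‖k‖^{-d-α}`. -/
def nuBar (d : ℕ) (α : ℝ) : ℝ :=
  ∑' k : Fin d → ℤ, gridNorm k ^ (-(d : ℝ) - α)

/-- The matrix `V`, for an enumeration `κ` of `K_ε`. -/
def gridMatrix {d : ℕ} (α : ℝ) (D : Set (EuclideanSpace ℝ (Fin d))) (ε : ℝ) {N : ℕ}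
    (κ : Fin N ≃ gridIndex D ε) : Matrix (Fin N) (Fin N) ℝ :=
  Matrix.of fun p q =>
    if p = q then
      fracConst d α / ε ^ α * (nuBar d α - (d : ℝ) ^ (-((d : ℝ) + α) / 2))
    else
      -(fracConst d α / ε ^ α) *
        gridNorm ((κ p : Fin d → ℤ) - (κ q : Fin d → ℤ)) ^ (-(d : ℝ) - α)

theorem gridNorm_sub_comm {d : ℕ} (k l : Fin d → ℤ) : gridNorm (k - l) = gridNorm (l - k) := by
  unfold gridNorm
  congr 1
  refine Finset.sum_congr rfl fun j _ => ?_
  simp only [Pi.sub_apply, Int.cast_sub]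
  rw [abs_sub_comm]

theorem gridMatrix_isHermitian {d : ℕ} (α : ℝ) (D : Set (EuclideanSpace ℝ (Fin d))) (ε : ℝ)
    {N : ℕ} (κ : Fin N ≃ gridIndex D ε) : (gridMatrix α D ε κ).IsHermitian := by
  refine Matrix.IsHermitian.ext fun p q => ?_
  simp only [gridMatrix, Matrix.of_apply, star_trivial, eq_comm (a := q) (b := p)]
  rw [gridNorm_sub_comm]

/-- The eigenvalues of `V`, counted with multiplicity, in nondecreasing order. -/
def sortedEigenvalues {d : ℕ} (α : ℝ) (D : Set (EuclideanSpace ℝ (Fin d))) (ε : ℝ) {N : ℕ}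
    (κ : Fin N ≃ gridIndex D ε) : Fin N → ℝ :=
  (gridMatrix_isHermitian α D ε κ).eigenvalues ∘
    Tuple.sort (gridMatrix_isHermitian α D ε κ).eigenvalues

/-- The lower bound `λ_{n,ε}`, for `n ≥ 1`: the `n`-th smallest eigenvalue of `V` if `n ≤ N` and
this eigenvalue does not exceed `c_{d,α} ε^{-α} ν̄`, and `c_{d,α} ε^{-α} ν̄` otherwise. -/
def lowerBound {d : ℕ} (α : ℝ) (D : Set (EuclideanSpace ℝ (Fin d))) (ε : ℝ) {N : ℕ}
    (κ : Fin N ≃ gridIndex D ε) (n : ℕ) : ℝ :=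
  if h : n - 1 < N then
    min (sortedEigenvalues α D ε κ ⟨n - 1, h⟩) (fracConst d α / ε ^ α * nuBar d α)
  else fracConst d α / ε ^ α * nuBar d α

end FracLap

end

/-!
The jump kernel `|x - y|^{-d-α}` is bounded below by a kernel that is constant on pairs of cubes of
side `ε`: if `x` and `y` lie in the cubes with indices `k` and `l`, then `|x - y| ≤ ε ‖k - l‖`
(`gridWeight_kernel_le`). For the smaller kernel the square `(f x - f y)²` can be expanded and
integrated explicitly. If `f` vanishes off `D` and `a_p` is the integral of `f` over the `p`-th cube,
this gives (`le_dirichletForm_self`)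

  `E(f, f) ≥ C ε^{-d} (ε^d ν̄ ‖f‖² - ∑_{p,q} ‖κ p - κ q‖^{-d-α} a_p a_q)`, `C = c_{d,α} ε^{-α}`.

Since `V_{p,q} = C (ν̄ δ_{p,q} - ‖κ p - κ q‖^{-d-α})`, the right-hand side equals
`C ν̄ (‖f‖² - ε^{-d} |a|²) + ε^{-d} ⟨V a, a⟩`, and `ε^{-d} |a|² ≤ ‖f‖²` by the Cauchy–Schwarz
inequality on each cube (`sum_cellIntegral_sq_le`).

The eigenvalues are then compared as in the min-max principle. Eigenfunctions for different
eigenvalues are orthogonal, so `E(u, u) ≤ λ_n ‖u‖²` on the span of the eigenfunctions with eigenvalue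
at most `λ_n` (`dirichletForm_le_of_mem_eigenSpan`). This span has dimension at least `n`, so it
contains some `u ≠ 0` for which the vector `a` is orthogonal to the eigenvectors of the `n - 1`
smallest eigenvalues of `V`; for this `u`, `⟨V a, a⟩ ≥ λ_{n,ε} |a|²` (`lowerBound_mul_le`). Together
with `λ_{n,ε} ≤ C ν̄` this yields `λ_{n,ε} ‖u‖² ≤ E(u, u) ≤ λ_n ‖u‖²`.
-/

namespace FracLap

variable {d : ℕ}

/-! ### The grid of cubes -/

/-- The index `k ∈ ℤ^d` of the half-open cube `∏_j [k_j ε, (k_j + 1) ε)` that contains `x`. Unlike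
the closed cubes `gridCube`, these form a partition of the whole space. -/
noncomputable def cell (ε : ℝ) (x : EuclideanSpace ℝ (Fin d)) : Fin d → ℤ :=
  fun j => ⌊x j / ε⌋

theorem measurable_cell (ε : ℝ) : Measurable (cell (d := d) ε) := by
  refine measurable_pi_lambda _ fun j => ?_
  exact Int.measurable_floor.comp (by fun_prop)

theorem cell_mul_le {ε : ℝ} (hε : 0 < ε) (x : EuclideanSpace ℝ (Fin d)) (j : Fin d) :
    (cell ε x j : ℝ) * ε ≤ x j :=
  (le_div_iff₀ hε).1 (Int.floor_le _)

theorem lt_cell_add_one_mul {ε : ℝ} (hε : 0 < ε) (x : EuclideanSpace ℝ (Fin d)) (j : Fin d) :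
    x j < ((cell ε x j : ℝ) + 1) * ε :=
  (div_lt_iff₀ hε).1 (Int.lt_floor_add_one _)

theorem cell_mem_gridIndex {D : Set (EuclideanSpace ℝ (Fin d))} {ε : ℝ} (hε : 0 < ε)
    {x : EuclideanSpace ℝ (Fin d)} (hx : x ∈ D) : cell ε x ∈ gridIndex D ε :=
  ⟨x, hx, fun j => ⟨cell_mul_le hε x j, (lt_cell_add_one_mul hε x j).le⟩⟩

theorem volume_preimage_cell {ε : ℝ} (hε : 0 < ε) (k : Fin d → ℤ) :
    volume (cell ε ⁻¹' {k}) = ENNReal.ofReal (ε ^ d) := by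
  have h : cell ε ⁻¹' {k} = (WithLp.ofLp : EuclideanSpace ℝ (Fin d) → Fin d → ℝ) ⁻¹'
      Set.univ.pi fun j => Set.Ico ((k j : ℝ) * ε) (((k j : ℝ) + 1) * ε) := by
    ext x
    simp only [Set.mem_preimage, Set.mem_singleton_iff, Set.mem_pi, Set.mem_univ, true_imp_iff,
      Set.mem_Ico, funext_iff, cell, Int.floor_eq_iff, le_div_iff₀ hε, div_lt_iff₀ hε]
  rw [h, (PiLp.volume_preserving_ofLp (Fin d)).measure_preimage
    (MeasurableSet.univ_pi fun _ => measurableSet_Ico).nullMeasurableSet, Real.volume_pi_Ico]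
  simp only [add_mul, one_mul, add_sub_cancel_left, Finset.prod_const, Finset.card_univ,
    Fintype.card_fin, ENNReal.ofReal_pow hε.le]

/-- The push-forward of Lebesgue measure to `ℤ^d`; it turns integrals of functions that are
constant on the cubes into sums over `ℤ^d`. -/
theorem map_cell_volume {ε : ℝ} (hε : 0 < ε) :
    (volume : Measure (EuclideanSpace ℝ (Fin d))).map (cell ε) =
      ENNReal.ofReal (ε ^ d) • Measure.count := by
  refine Measure.ext_of_singleton fun k => ?_
  rw [Measure.map_apply (measurable_cell ε) (measurableSet_singleton k), volume_preimage_cell hε]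
  simp

theorem integrable_comp_cell_iff {ε : ℝ} (hε : 0 < ε) (g : (Fin d → ℤ) → ℝ) :
    Integrable (fun x : EuclideanSpace ℝ (Fin d) => g (cell ε x)) ↔ Summable g := by
  have h : Integrable g ((volume : Measure (EuclideanSpace ℝ (Fin d))).map (cell ε)) ↔
      Integrable (g ∘ cell ε) (volume : Measure (EuclideanSpace ℝ (Fin d))) :=
    integrable_map_measure (measurable_of_countable g).aestronglyMeasurable
      (measurable_cell ε).aemeasurable
  rw [map_cell_volume hε, integrable_smul_measure (by simp; positivity) ENNReal.ofReal_ne_top,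
    integrable_count_iff, summable_norm_iff] at h
  exact h.symm

theorem integral_comp_cell {ε : ℝ} (hε : 0 < ε) {g : (Fin d → ℤ) → ℝ} (hg : Summable g) :
    ∫ x : EuclideanSpace ℝ (Fin d), g (cell ε x) = ε ^ d * ∑' k, g k := by
  have hg' : Integrable g (Measure.count : Measure (Fin d → ℤ)) := integrable_count_iff.2 hg.norm
  rw [← integral_map (φ := cell ε) (f := g) (measurable_cell ε).aemeasurable
    (measurable_of_countable g).aestronglyMeasurable, map_cell_volume hε, integral_smul_measure,
    ENNReal.toReal_ofReal (by positivity), integral_countable hg', smul_eq_mul]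
  simp [Measure.real]

/-! ### The weights and the jump kernel -/

/-- The weight `‖k‖^{-d-α}` on `ℤ^d`. -/
noncomputable def gridWeight (α : ℝ) (k : Fin d → ℤ) : ℝ :=
  gridNorm k ^ (-(d : ℝ) - α)

theorem one_le_gridNorm (hd : 0 < d) (k : Fin d → ℤ) : 1 ≤ gridNorm k := by
  refine Real.le_sqrt_of_sq_le ?_
  calc (1 : ℝ) ^ 2 ≤ (|(k ⟨0, hd⟩ : ℝ)| + 1) ^ 2 := by
        gcongr; linarith [abs_nonneg (k ⟨0, hd⟩ : ℝ)]
    _ ≤ _ := Finset.single_le_sum (f := fun j => (|(k j : ℝ)| + 1) ^ 2)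
        (fun _ _ => sq_nonneg _) (Finset.mem_univ _)

theorem gridWeight_nonneg (α : ℝ) (k : Fin d → ℤ) : 0 ≤ gridWeight α k :=
  Real.rpow_nonneg (Real.sqrt_nonneg _) _

theorem gridWeight_zero (α : ℝ) :
    gridWeight α (0 : Fin d → ℤ) = (d : ℝ) ^ (-((d : ℝ) + α) / 2) := by
  simp only [gridWeight, gridNorm, Pi.zero_apply, Int.cast_zero, abs_zero, zero_add, one_pow,
    Finset.sum_const, Finset.card_univ, Fintype.card_fin, nsmul_eq_mul, mul_one]
  rw [Real.sqrt_eq_rpow, ← Real.rpow_mul (Nat.cast_nonneg d)]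
  congr 1
  ring

theorem norm_le_mul_gridNorm {ε : ℝ} (hε : 0 < ε) (z : EuclideanSpace ℝ (Fin d))
    (k : Fin d → ℤ) (h : ∀ j, |z j| ≤ ε * (|(k j : ℝ)| + 1)) : ‖z‖ ≤ ε * gridNorm k := by
  rw [EuclideanSpace.norm_eq]
  refine Real.sqrt_le_iff.2 ⟨mul_nonneg hε.le (Real.sqrt_nonneg _), ?_⟩
  rw [mul_pow, gridNorm, Real.sq_sqrt (Finset.sum_nonneg fun _ _ => sq_nonneg _), Finset.mul_sum]
  refine Finset.sum_le_sum fun j _ => ?_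
  rw [← mul_pow, Real.norm_eq_abs]
  exact pow_le_pow_left₀ (abs_nonneg _) (h j) 2

theorem norm_le_gridNorm_cell {ε : ℝ} (hε : 0 < ε) (x : EuclideanSpace ℝ (Fin d)) :
    ‖x‖ ≤ ε * gridNorm (cell ε x) := by
  refine norm_le_mul_gridNorm hε _ _ fun j => ?_
  have h1 := cell_mul_le hε x j
  have h2 := lt_cell_add_one_mul hε x j
  have h3 := mul_le_mul_of_nonneg_right (le_abs_self (cell ε x j : ℝ)) hε.le
  have h4 := mul_le_mul_of_nonneg_right (neg_abs_le (cell ε x j : ℝ)) hε.le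
  exact abs_le.2 ⟨by linarith, by linarith⟩

theorem norm_sub_le_gridNorm_cell {ε : ℝ} (hε : 0 < ε) (x y : EuclideanSpace ℝ (Fin d)) :
    ‖x - y‖ ≤ ε * gridNorm (cell ε x - cell ε y) := by
  refine norm_le_mul_gridNorm hε _ _ fun j => ?_
  have h1 := cell_mul_le hε x j
  have h2 := lt_cell_add_one_mul hε x j
  have h1' := cell_mul_le hε y j
  have h2' := lt_cell_add_one_mul hε y j
  simp only [PiLp.sub_apply, Pi.sub_apply, Int.cast_sub]
  have h3 := mul_le_mul_of_nonneg_right (le_abs_self ((cell ε x j : ℝ) - cell ε y j)) hε.le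
  have h4 := mul_le_mul_of_nonneg_right (neg_abs_le ((cell ε x j : ℝ) - cell ε y j)) hε.le
  exact abs_le.2 ⟨by linarith, by linarith⟩

/-- The series `ν̄` converges, because `‖k‖^{-d-α}` on the unit cube with index `k` is dominated by
a multiple of the integrable function `(1 + ‖x‖)^{-d-α}`. -/
theorem summable_gridWeight (hd : 0 < d) {α : ℝ} (hα : 0 < α) :
    Summable (gridWeight α : (Fin d → ℤ) → ℝ) := by
  rw [← integrable_comp_cell_iff one_pos]
  have hI : Integrable (fun x : EuclideanSpace ℝ (Fin d) => (1 + ‖x‖) ^ (-((d : ℝ) + α))) :=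
    integrable_one_add_norm (by simpa using hα)
  refine (hI.const_mul ((2 : ℝ) ^ ((d : ℝ) + α))).mono'
    (((measurable_of_countable (gridWeight α)).comp (measurable_cell 1)).aestronglyMeasurable)
    (.of_forall fun x => ?_)
  rw [Real.norm_of_nonneg (gridWeight_nonneg _ _)]
  have h1 := norm_le_gridNorm_cell one_pos x
  have h2 := one_le_gridNorm hd (cell 1 x)
  have h3 : (1 + ‖x‖) / 2 ≤ gridNorm (cell 1 x) := by linarith
  calc gridWeight α (cell 1 x) = gridNorm (cell 1 x) ^ (-((d : ℝ) + α)) := by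
        rw [gridWeight, neg_add']
    _ ≤ ((1 + ‖x‖) / 2) ^ (-((d : ℝ) + α)) :=
        Real.rpow_le_rpow_of_nonpos (by positivity) h3 (by linarith [(Nat.cast_nonneg d : (0:ℝ) ≤ d)])
    _ = (2 : ℝ) ^ ((d : ℝ) + α) * (1 + ‖x‖) ^ (-((d : ℝ) + α)) := by
        rw [Real.div_rpow (by positivity) (by norm_num), Real.rpow_neg zero_le_two, div_inv_eq_mul,
          mul_comm]

theorem tsum_gridWeight_sub (α : ℝ) (k : Fin d → ℤ) :
    ∑' l, gridWeight α (k - l) = nuBar d α :=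
  (Equiv.subLeft k).tsum_eq (gridWeight α)

theorem fracConst_pos {α : ℝ} (hα0 : 0 < α) (hα2 : α < 2) : 0 < fracConst d α := by
  have h : Real.Gamma (-α / 2) ≠ 0 := by
    refine Real.Gamma_ne_zero fun m hm => ?_
    have h1 : (0 : ℝ) < m := by linarith
    have h2 : (m : ℝ) < 1 := by linarith
    have h3 : 0 < m := by exact_mod_cast h1
    have h4 : m < 1 := by exact_mod_cast h2
    omega
  have hG : 0 < Real.Gamma (((d : ℝ) + α) / 2) := Real.Gamma_pos_of_pos (by positivity)
  have := Real.pi_pos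
  unfold fracConst
  positivity

/-- Pointwise comparison of the jump kernel with a kernel that is constant on pairs of cubes. On the
diagonal, where the kernel has the value `0`, the difference of the values vanishes. -/
theorem gridWeight_kernel_le {α ε : ℝ} (hα : 0 < α) (hε : 0 < ε)
    (f : EuclideanSpace ℝ (Fin d) → ℝ) (x y : EuclideanSpace ℝ (Fin d)) :
    ε ^ (-((d : ℝ) + α)) * ((f x - f y) ^ 2 * gridWeight α (cell ε x - cell ε y)) ≤
      (f x - f y) * (f x - f y) / ‖x - y‖ ^ ((d : ℝ) + α) := by
  rcases eq_or_ne x y with rfl | hxy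
  · simp
  have hpos : 0 < ‖x - y‖ := norm_pos_iff.2 (sub_ne_zero.2 hxy)
  have h : ε ^ (-((d : ℝ) + α)) * gridWeight α (cell ε x - cell ε y) ≤
      ‖x - y‖ ^ (-((d : ℝ) + α)) := by
    rw [gridWeight, ← neg_add', ← Real.mul_rpow hε.le (show 0 ≤ gridNorm _ from Real.sqrt_nonneg _)]
    exact Real.rpow_le_rpow_of_nonpos hpos (norm_sub_le_gridNorm_cell hε x y)
      (by linarith [(Nat.cast_nonneg d : (0 : ℝ) ≤ d)])
  rw [div_eq_mul_inv, ← Real.rpow_neg hpos.le, ← sq, mul_left_comm]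
  exact mul_le_mul_of_nonneg_left h (sq_nonneg _)

/-! ### Integrals over the cubes -/

/-- The integral of `f` over the half-open grid cube with index `k`. -/
noncomputable def cellIntegral (ε : ℝ) (f : EuclideanSpace ℝ (Fin d) → ℝ) (k : Fin d → ℤ) : ℝ :=
  ∫ x in cell ε ⁻¹' {k}, f x

theorem measurableSet_preimage_cell (ε : ℝ) (k : Fin d → ℤ) :
    MeasurableSet (cell ε ⁻¹' {k}) :=
  measurable_cell ε (measurableSet_singleton k)

theorem integrableOn_preimage_cell {ε : ℝ} (hε : 0 < ε) {f : EuclideanSpace ℝ (Fin d) → ℝ}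
    (hf : MemLp f 2) (k : Fin d → ℤ) : IntegrableOn f (cell ε ⁻¹' {k}) := by
  have : Fact (volume (cell (d := d) ε ⁻¹' {k}) < ∞) :=
    ⟨by rw [volume_preimage_cell hε]; exact ENNReal.ofReal_lt_top⟩
  exact (hf.restrict _).integrable one_le_two

/-- Only the cubes that meet `D` contribute to a function that vanishes off `D`. -/
theorem sum_indicator_preimage_cell {D : Set (EuclideanSpace ℝ (Fin d))} {ε : ℝ} (hε : 0 < ε)
    {N : ℕ} (κ : Fin N ≃ gridIndex D ε) {f : EuclideanSpace ℝ (Fin d) → ℝ}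
    (hfD : ∀ x ∉ D, f x = 0) (x : EuclideanSpace ℝ (Fin d)) :
    ∑ p, (cell ε ⁻¹' {(κ p : Fin d → ℤ)}).indicator f x = f x := by
  by_cases hx : x ∈ D
  · set p₀ := κ.symm ⟨cell ε x, cell_mem_gridIndex hε hx⟩ with hp₀
    have hκ : (κ p₀ : Fin d → ℤ) = cell ε x := by simp [hp₀]
    rw [Finset.sum_eq_single p₀ (fun p _ hp => ?_) (by simp)]
    · exact Set.indicator_of_mem (by simp [hκ]) f
    · refine Set.indicator_of_notMem (fun h => hp (κ.injective (Subtype.ext ?_))) f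
      rw [hκ]
      exact h.symm
  · simp [Set.indicator, hfD x hx]

theorem sum_cellIntegral {D : Set (EuclideanSpace ℝ (Fin d))} {ε : ℝ} (hε : 0 < ε)
    {N : ℕ} (κ : Fin N ≃ gridIndex D ε) {f : EuclideanSpace ℝ (Fin d) → ℝ}
    (hf : Integrable f) (hfD : ∀ x ∉ D, f x = 0) :
    ∑ p, cellIntegral ε f (κ p) = ∫ x, f x := by
  simp_rw [cellIntegral, ← integral_indicator (measurableSet_preimage_cell ε _)]
  rw [← integral_finsetSum _ fun p _ => hf.indicator (measurableSet_preimage_cell ε _)]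
  simp_rw [sum_indicator_preimage_cell hε κ hfD]

/-- The Cauchy–Schwarz inequality on a single cube. -/
theorem cellIntegral_sq_le {ε : ℝ} (hε : 0 < ε) {f : EuclideanSpace ℝ (Fin d) → ℝ}
    (hf : MemLp f 2) (k : Fin d → ℤ) :
    cellIntegral ε f k ^ 2 ≤ ε ^ d * cellIntegral ε (fun x => f x ^ 2) k := by
  have hε' : 0 < ε ^ d := pow_pos hε d
  set Q := cell (d := d) ε ⁻¹' {k}
  have hvol : volume.real Q = ε ^ d := by
    rw [Measure.real, volume_preimage_cell hε, ENNReal.toReal_ofReal hε'.le]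
  have hfin : volume Q ≠ ∞ := by
    rw [volume_preimage_cell hε]; exact ENNReal.ofReal_ne_top
  have h1 : IntegrableOn f Q := integrableOn_preimage_cell hε hf k
  have h2 : IntegrableOn (fun x => f x ^ 2) Q := hf.integrable_sq.integrableOn
  set a := cellIntegral ε f k with ha
  set t := a / ε ^ d with ht
  -- The variance of `f` on the cube is nonnegative.
  have h0 : 0 ≤ ∫ x in Q, (f x - t) ^ 2 := integral_nonneg fun _ => sq_nonneg _
  have h3 : ∫ x in Q, (f x - t) ^ 2 =
      cellIntegral ε (fun x => f x ^ 2) k - 2 * t * a + t ^ 2 * ε ^ d := by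
    have : ∀ x, (f x - t) ^ 2 = f x ^ 2 - 2 * t * f x + t ^ 2 := fun x => by ring
    simp_rw [this]
    rw [integral_add (h2.sub' (h1.const_mul _)) (integrableOn_const hfin),
      integral_sub h2 (h1.const_mul _), integral_const_mul, setIntegral_const, hvol, smul_eq_mul,
      mul_comm (ε ^ d)]
    rfl
  rw [h3] at h0
  have h4 : a = t * ε ^ d := by rw [ht]; field_simp
  rw [h4] at h0 ⊢
  nlinarith

theorem sum_cellIntegral_sq_le {D : Set (EuclideanSpace ℝ (Fin d))} {ε : ℝ} (hε : 0 < ε)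
    {N : ℕ} (κ : Fin N ≃ gridIndex D ε) {f : EuclideanSpace ℝ (Fin d) → ℝ}
    (hf : MemLp f 2) (hfD : ∀ x ∉ D, f x = 0) :
    ∑ p, cellIntegral ε f (κ p) ^ 2 ≤ ε ^ d * ∫ x, f x ^ 2 := by
  rw [← sum_cellIntegral hε κ hf.integrable_sq (fun x hx => by simp [hfD x hx]), Finset.mul_sum]
  exact Finset.sum_le_sum fun p _ => cellIntegral_sq_le hε hf _

/-! ### The energy for the piecewise constant kernel -/

theorem measurable_gridWeight_cell_sub (α ε : ℝ) :
    Measurable fun z : EuclideanSpace ℝ (Fin d) × EuclideanSpace ℝ (Fin d) =>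
      gridWeight α (cell ε z.1 - cell ε z.2) :=
  (measurable_of_countable (gridWeight α)).comp
    (((measurable_cell ε).comp measurable_fst).sub ((measurable_cell ε).comp measurable_snd))

theorem gridWeight_sub_comm (α : ℝ) (k l : Fin d → ℤ) :
    gridWeight α (k - l) = gridWeight α (l - k) := by
  rw [gridWeight, gridNorm_sub_comm, gridWeight]

theorem integral_gridWeight_cell_sub (hd : 0 < d) {α ε : ℝ} (hα : 0 < α) (hε : 0 < ε)
    (k : Fin d → ℤ) :
    Integrable (fun y : EuclideanSpace ℝ (Fin d) => gridWeight α (k - cell ε y)) ∧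
      ∫ y : EuclideanSpace ℝ (Fin d), gridWeight α (k - cell ε y) = ε ^ d * nuBar d α := by
  have hs : Summable fun l : Fin d → ℤ => gridWeight α (k - l) :=
    (Equiv.subLeft k).summable_iff.2 (summable_gridWeight hd hα)
  refine ⟨(integrable_comp_cell_iff hε fun l => gridWeight α (k - l)).2 hs, ?_⟩
  rw [integral_comp_cell hε hs, tsum_gridWeight_sub]

/-- Integrating out the variable that `g` does not depend on leaves the constant `ε^d ν̄`. -/
theorem integral_mul_gridWeight_fst (hd : 0 < d) {α ε : ℝ} (hα : 0 < α) (hε : 0 < ε)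
    {g : EuclideanSpace ℝ (Fin d) → ℝ} (hg : Integrable g) :
    Integrable (fun z : EuclideanSpace ℝ (Fin d) × EuclideanSpace ℝ (Fin d) =>
        g z.1 * gridWeight α (cell ε z.1 - cell ε z.2)) ∧
      ∫ z : EuclideanSpace ℝ (Fin d) × EuclideanSpace ℝ (Fin d),
        g z.1 * gridWeight α (cell ε z.1 - cell ε z.2) = ε ^ d * nuBar d α * ∫ x, g x := by
  have hi : Integrable (fun z : EuclideanSpace ℝ (Fin d) × EuclideanSpace ℝ (Fin d) =>
      g z.1 * gridWeight α (cell ε z.1 - cell ε z.2)) := by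
    have hm : AEStronglyMeasurable
        (fun z : EuclideanSpace ℝ (Fin d) × EuclideanSpace ℝ (Fin d) =>
          g z.1 * gridWeight α (cell ε z.1 - cell ε z.2)) (volume.prod volume) :=
      hg.aestronglyMeasurable.comp_fst.mul (measurable_gridWeight_cell_sub α ε).aestronglyMeasurable
    rw [Measure.volume_eq_prod, integrable_prod_iff hm]
    refine ⟨.of_forall fun x => (integral_gridWeight_cell_sub hd hα hε (cell ε x)).1.const_mul (g x), ?_⟩
    simp_rw [norm_mul, Real.norm_of_nonneg (gridWeight_nonneg α _), integral_const_mul,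
      (integral_gridWeight_cell_sub hd hα hε _).2]
    exact hg.norm.mul_const _
  refine ⟨hi, ?_⟩
  rw [Measure.volume_eq_prod] at hi ⊢
  rw [integral_prod _ hi]
  simp_rw [integral_const_mul, (integral_gridWeight_cell_sub hd hα hε _).2]
  rw [integral_mul_const, mul_comm]

theorem integral_mul_gridWeight_snd (hd : 0 < d) {α ε : ℝ} (hα : 0 < α) (hε : 0 < ε)
    {g : EuclideanSpace ℝ (Fin d) → ℝ} (hg : Integrable g) :
    Integrable (fun z : EuclideanSpace ℝ (Fin d) × EuclideanSpace ℝ (Fin d) =>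
        g z.2 * gridWeight α (cell ε z.1 - cell ε z.2)) ∧
      ∫ z : EuclideanSpace ℝ (Fin d) × EuclideanSpace ℝ (Fin d),
        g z.2 * gridWeight α (cell ε z.1 - cell ε z.2) = ε ^ d * nuBar d α * ∫ x, g x := by
  obtain ⟨h1, h2⟩ := integral_mul_gridWeight_fst hd hα hε hg
  rw [Measure.volume_eq_prod] at h1 h2 ⊢
  simp_rw [gridWeight_sub_comm α (cell ε (Prod.fst _))]
  refine ⟨h1.swap, ?_⟩
  rw [← h2]
  exact integral_prod_swap (μ := volume) (ν := volume)
    fun z : EuclideanSpace ℝ (Fin d) × EuclideanSpace ℝ (Fin d) =>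
      g z.1 * gridWeight α (cell ε z.1 - cell ε z.2)

theorem integral_mul_mul_gridWeight {D : Set (EuclideanSpace ℝ (Fin d))} {ε : ℝ} (hε : 0 < ε)
    (α : ℝ) {N : ℕ} (κ : Fin N ≃ gridIndex D ε) {f : EuclideanSpace ℝ (Fin d) → ℝ}
    (hf : MemLp f 2) (hfD : ∀ x ∉ D, f x = 0) :
    Integrable (fun z : EuclideanSpace ℝ (Fin d) × EuclideanSpace ℝ (Fin d) =>
        f z.1 * f z.2 * gridWeight α (cell ε z.1 - cell ε z.2)) ∧
      ∫ z : EuclideanSpace ℝ (Fin d) × EuclideanSpace ℝ (Fin d),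
        f z.1 * f z.2 * gridWeight α (cell ε z.1 - cell ε z.2) =
      ∑ p, ∑ q, gridWeight α ((κ p : Fin d → ℤ) - (κ q : Fin d → ℤ)) *
        (cellIntegral ε f (κ p) * cellIntegral ε f (κ q)) := by
  set F : Fin N → EuclideanSpace ℝ (Fin d) → ℝ :=
    fun p => (cell ε ⁻¹' {(κ p : Fin d → ℤ)}).indicator f with hF
  have hFi : ∀ p, Integrable (F p) := fun p =>
    (integrableOn_preimage_cell hε hf _).integrable_indicator (measurableSet_preimage_cell ε _)
  have hFint : ∀ p, ∫ x, F p x = cellIntegral ε f (κ p) := fun p =>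
    integral_indicator (measurableSet_preimage_cell ε _)
  have hFcell : ∀ p x, F p x ≠ 0 → cell ε x = κ p := fun p x h =>
    (Set.mem_of_indicator_ne_zero h : x ∈ cell ε ⁻¹' {(κ p : Fin d → ℤ)})
  have hpt : ∀ z : EuclideanSpace ℝ (Fin d) × EuclideanSpace ℝ (Fin d),
      f z.1 * f z.2 * gridWeight α (cell ε z.1 - cell ε z.2) =
        ∑ p, ∑ q, gridWeight α ((κ p : Fin d → ℤ) - (κ q : Fin d → ℤ)) * (F p z.1 * F q z.2) := fun z => by
    rw [← sum_indicator_preimage_cell hε κ hfD z.1, ← sum_indicator_preimage_cell hε κ hfD z.2,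
      Finset.sum_mul_sum, Finset.sum_mul]
    refine Finset.sum_congr rfl fun p _ => ?_
    rw [Finset.sum_mul]
    refine Finset.sum_congr rfl fun q _ => ?_
    change F p z.1 * F q z.2 * _ = _
    by_cases h1 : F p z.1 = 0
    · simp [h1]
    by_cases h2 : F q z.2 = 0
    · simp [h2]
    rw [hFcell p _ h1, hFcell q _ h2, mul_comm]
  have hi : ∀ p q, Integrable (fun z : EuclideanSpace ℝ (Fin d) × EuclideanSpace ℝ (Fin d) =>
      gridWeight α ((κ p : Fin d → ℤ) - (κ q : Fin d → ℤ)) * (F p z.1 * F q z.2)) := fun p q =>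
    ((hFi p).mul_prod (hFi q)).const_mul _
  simp_rw [hpt]
  refine ⟨integrable_finsetSum _ fun p _ => integrable_finsetSum _ fun q _ => hi p q, ?_⟩
  rw [integral_finsetSum _ fun p _ => integrable_finsetSum _ fun q _ => hi p q]
  refine Finset.sum_congr rfl fun p _ => ?_
  rw [integral_finsetSum _ fun q _ => hi p q]
  refine Finset.sum_congr rfl fun q _ => ?_
  rw [integral_const_mul, Measure.volume_eq_prod, integral_prod_mul, hFint, hFint]

/-- The energy of `f` is bounded below by the energy for the kernel that is constant on pairs of
cubes, which depends only on `‖f‖₂` and on the integrals of `f` over the cubes. -/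
theorem le_dirichletForm_self (hd : 0 < d) {α ε : ℝ} (hα0 : 0 < α) (hα2 : α < 2) (hε : 0 < ε)
    {D : Set (EuclideanSpace ℝ (Fin d))} {N : ℕ} (κ : Fin N ≃ gridIndex D ε)
    {f : EuclideanSpace ℝ (Fin d) → ℝ} (hf : MemLp f 2) (hfD : ∀ x ∉ D, f x = 0)
    (hfi : Integrable fun z : EuclideanSpace ℝ (Fin d) × EuclideanSpace ℝ (Fin d) =>
      (f z.1 - f z.2) * (f z.1 - f z.2) / ‖z.1 - z.2‖ ^ ((d : ℝ) + α)) :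
    fracConst d α * ε ^ (-((d : ℝ) + α)) * (ε ^ d * nuBar d α * (∫ x, f x ^ 2) -
      ∑ p, ∑ q, gridWeight α ((κ p : Fin d → ℤ) - (κ q : Fin d → ℤ)) *
        (cellIntegral ε f (κ p) * cellIntegral ε f (κ q))) ≤ dirichletForm α f f := by
  obtain ⟨i1, e1⟩ := integral_mul_gridWeight_fst hd hα0 hε hf.integrable_sq
  obtain ⟨i2, e2⟩ := integral_mul_gridWeight_snd hd hα0 hε hf.integrable_sq
  obtain ⟨i3, e3⟩ := integral_mul_mul_gridWeight hε α κ hf hfD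
  have hpt : ∀ z : EuclideanSpace ℝ (Fin d) × EuclideanSpace ℝ (Fin d),
      (f z.1 - f z.2) ^ 2 * gridWeight α (cell ε z.1 - cell ε z.2) =
        f z.1 ^ 2 * gridWeight α (cell ε z.1 - cell ε z.2) +
        f z.2 ^ 2 * gridWeight α (cell ε z.1 - cell ε z.2) -
        2 * (f z.1 * f z.2 * gridWeight α (cell ε z.1 - cell ε z.2)) := fun z => by ring
  have hint : Integrable (fun z : EuclideanSpace ℝ (Fin d) × EuclideanSpace ℝ (Fin d) =>
      (f z.1 - f z.2) ^ 2 * gridWeight α (cell ε z.1 - cell ε z.2)) := by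
    simp_rw [hpt]
    exact (i1.add i2).sub (i3.const_mul 2)
  have hval : ∫ z : EuclideanSpace ℝ (Fin d) × EuclideanSpace ℝ (Fin d),
      (f z.1 - f z.2) ^ 2 * gridWeight α (cell ε z.1 - cell ε z.2) =
        2 * (ε ^ d * nuBar d α * (∫ x, f x ^ 2) -
          ∑ p, ∑ q, gridWeight α ((κ p : Fin d → ℤ) - (κ q : Fin d → ℤ)) *
            (cellIntegral ε f (κ p) * cellIntegral ε f (κ q))) := by
    simp_rw [hpt]
    rw [integral_sub (i1.fun_add i2) (i3.const_mul 2), integral_add i1 i2, integral_const_mul,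
      e1, e2, e3]
    ring
  have hle := integral_mono (hint.const_mul _) hfi fun z => gridWeight_kernel_le hα0 hε f z.1 z.2
  rw [integral_const_mul, hval] at hle
  have hc := fracConst_pos (d := d) hα0 hα2
  calc _ = fracConst d α / 2 * (ε ^ (-((d : ℝ) + α)) * (2 * (ε ^ d * nuBar d α * (∫ x, f x ^ 2) -
          ∑ p, ∑ q, gridWeight α ((κ p : Fin d → ℤ) - (κ q : Fin d → ℤ)) *
            (cellIntegral ε f (κ p) * cellIntegral ε f (κ q))))) := by ring
    _ ≤ dirichletForm α f f := mul_le_mul_of_nonneg_left hle (by positivity)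

/-! ### The matrix `V` and its eigenvalues -/

/-- The quadratic form of a real symmetric matrix on the span of those eigenvectors whose eigenvalue
is at least `m`. -/
theorem mul_sum_sq_le_quadraticForm {N : ℕ} {A : Matrix (Fin N) (Fin N) ℝ} (hA : A.IsHermitian)
    (v : Fin N → ℝ) {m : ℝ}
    (h : ∀ i, ∑ p, hA.eigenvectorBasis i p * v p ≠ 0 → m ≤ hA.eigenvalues i) :
    m * ∑ p, v p ^ 2 ≤ ∑ p, ∑ q, A p q * (v p * v q) := by
  set b := hA.eigenvectorBasis with hb
  have hin : ∀ (i : Fin N) (w : Fin N → ℝ),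
      inner ℝ (b i) (WithLp.toLp 2 w) = ∑ p, b i p * w p := fun i w => by
    simp [PiLp.inner_apply, mul_comm]
  have hAv : ∀ i, ∑ p, b i p * (A.mulVec v) p = hA.eigenvalues i * ∑ p, b i p * v p := fun i => by
    have h1 := hA.mulVec_eigenvectorBasis i
    have hT : A.transpose = A := by
      have := hA.eq
      rwa [Matrix.conjTranspose_eq_transpose_of_trivial] at this
    change (b i).ofLp ⬝ᵥ A.mulVec v = hA.eigenvalues i * ((b i).ofLp ⬝ᵥ v)
    rw [Matrix.dotProduct_mulVec, ← Matrix.mulVec_transpose, hT, hb, h1, smul_dotProduct,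
      smul_eq_mul]
  have e1 := b.sum_inner_mul_inner (WithLp.toLp 2 v) (WithLp.toLp 2 v)
  have e2 := b.sum_inner_mul_inner (WithLp.toLp 2 v) (WithLp.toLp 2 (A.mulVec v))
  simp_rw [real_inner_comm (b _) (WithLp.toLp 2 v), hin] at e1 e2
  simp_rw [hAv] at e2
  have e3 : inner ℝ (WithLp.toLp 2 v) (WithLp.toLp 2 v : EuclideanSpace ℝ (Fin N)) =
      ∑ p, v p ^ 2 := by
    simp only [PiLp.inner_apply, RCLike.inner_apply, conj_trivial, sq]
  have e4 : inner ℝ (WithLp.toLp 2 v) (WithLp.toLp 2 (A.mulVec v) : EuclideanSpace ℝ (Fin N)) =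
      ∑ p, ∑ q, A p q * (v p * v q) := by
    simp only [PiLp.inner_apply, Matrix.mulVec, dotProduct, RCLike.inner_apply, conj_trivial,
      Finset.sum_mul]
    exact Finset.sum_congr rfl fun p _ => Finset.sum_congr rfl fun q _ => by ring
  rw [e3] at e1
  rw [e4] at e2
  rw [← e1, ← e2, Finset.mul_sum]
  refine Finset.sum_le_sum fun i _ => ?_
  by_cases hi : ∑ p, b i p * v p = 0
  · simp [hi]
  · nlinarith [mul_le_mul_of_nonneg_right (h i hi) (mul_self_nonneg (∑ p, b i p * v p))]

theorem sum_gridMatrix_mul {α ε : ℝ} {D : Set (EuclideanSpace ℝ (Fin d))} {N : ℕ}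
    (κ : Fin N ≃ gridIndex D ε) (v : Fin N → ℝ) :
    ∑ p, ∑ q, gridMatrix α D ε κ p q * (v p * v q) =
      fracConst d α / ε ^ α * nuBar d α * (∑ p, v p ^ 2) - fracConst d α / ε ^ α *
        ∑ p, ∑ q, gridWeight α ((κ p : Fin d → ℤ) - (κ q : Fin d → ℤ)) * (v p * v q) := by
  have h : ∀ p q, gridMatrix α D ε κ p q * (v p * v q) =
      (if p = q then fracConst d α / ε ^ α * nuBar d α * (v p * v q) else 0) -
        fracConst d α / ε ^ α *
          (gridWeight α ((κ p : Fin d → ℤ) - (κ q : Fin d → ℤ)) * (v p * v q)) := fun p q => by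
    by_cases hpq : p = q
    · subst hpq
      simp only [gridMatrix, Matrix.of_apply, if_true, sub_self, gridWeight_zero]
      ring
    · simp only [gridMatrix, Matrix.of_apply, if_neg hpq, gridWeight]
      ring
  simp_rw [h, Finset.sum_sub_distrib, Finset.sum_ite_eq, Finset.mem_univ, if_true, Finset.mul_sum,
    sq]

theorem lowerBound_le_nuBar (α : ℝ) (D : Set (EuclideanSpace ℝ (Fin d))) (ε : ℝ) {N : ℕ}
    (κ : Fin N ≃ gridIndex D ε) (n : ℕ) :
    lowerBound α D ε κ n ≤ fracConst d α / ε ^ α * nuBar d α := by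
  unfold lowerBound
  split_ifs
  · exact min_le_right _ _
  · exact le_rfl

theorem lowerBound_le_sortedEigenvalues (α : ℝ) (D : Set (EuclideanSpace ℝ (Fin d))) (ε : ℝ) {N : ℕ}
    (κ : Fin N ≃ gridIndex D ε) {n : ℕ} {i : Fin N} (hi : n - 1 ≤ i) :
    lowerBound α D ε κ n ≤ sortedEigenvalues α D ε κ i := by
  rw [lowerBound, dif_pos (hi.trans_lt i.2)]
  exact (min_le_left _ _).trans (Tuple.monotone_sort _ (Fin.mk_le_of_le_val hi))

/-- If `v` is orthogonal to the eigenvectors of the `n - 1` smallest eigenvalues of `V`, the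
quadratic form of `V` at `v` is at least `λ_{n,ε} |v|²`. For `n > N` there are no other eigenvectors
left, and `v = 0`. -/
theorem lowerBound_mul_le (α : ℝ) (D : Set (EuclideanSpace ℝ (Fin d))) (ε : ℝ) {N : ℕ}
    (κ : Fin N ≃ gridIndex D ε) (n : ℕ) (v : Fin N → ℝ)
    (hv : ∀ i : Fin N, (i : ℕ) < n - 1 →
      ∑ p, (gridMatrix_isHermitian α D ε κ).eigenvectorBasis
        (Tuple.sort (gridMatrix_isHermitian α D ε κ).eigenvalues i) p * v p = 0) :
    lowerBound α D ε κ n * ∑ p, v p ^ 2 ≤ ∑ p, ∑ q, gridMatrix α D ε κ p q * (v p * v q) := by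
  refine mul_sum_sq_le_quadraticForm (gridMatrix_isHermitian α D ε κ) v fun i hi => ?_
  set σ := Tuple.sort (gridMatrix_isHermitian α D ε κ).eigenvalues with hσ
  have h := lowerBound_le_sortedEigenvalues α D ε κ (n := n) (i := σ.symm i) (by
    by_contra! hlt
    exact hi (by simpa using hv (σ.symm i) hlt))
  simpa [sortedEigenvalues, ← hσ] using h

/-- A subspace of dimension greater than `m` contains a nonzero vector that is orthogonal to `m`
given vectors. -/
theorem exists_ne_zero_forall_inner_eq_zero {E : Type*} [NormedAddCommGroup E]
    [InnerProductSpace ℝ E] (S : Submodule ℝ E) {m : ℕ} (hS : (m : Cardinal) < Module.rank ℝ S)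
    (b : Fin m → E) : ∃ u ∈ S, u ≠ 0 ∧ ∀ i, inner ℝ (b i) u = 0 := by
  set T : S →ₗ[ℝ] Fin m → ℝ := LinearMap.pi fun i => (innerₗ E (b i)).comp S.subtype
  have hT : ¬ Function.Injective T := fun h => by
    have h1 := LinearMap.lift_rank_le_of_injective T h
    rw [rank_fin_fun, Cardinal.lift_natCast, Cardinal.lift_id'] at h1
    exact absurd h1 (not_le.2 (by simpa using hS))
  rw [← LinearMap.ker_eq_bot, Submodule.eq_bot_iff] at hT
  push Not at hT
  obtain ⟨u, hu, hu0⟩ := hT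
  refine ⟨u, u.2, fun h => hu0 (Subtype.ext h), fun i => ?_⟩
  exact congr_fun (LinearMap.mem_ker.1 hu) i

/-! ### The Dirichlet form on linear combinations -/

/-- The fractional difference quotient `(f x - f y) / |x - y|^{(d+α)/2}`, whose square-integrability
over `ℝ^d × ℝ^d` means that `f` has finite energy. -/
noncomputable def diffQuot (α : ℝ) (f : EuclideanSpace ℝ (Fin d) → ℝ)
    (z : EuclideanSpace ℝ (Fin d) × EuclideanSpace ℝ (Fin d)) : ℝ :=
  (f z.1 - f z.2) / ‖z.1 - z.2‖ ^ (((d : ℝ) + α) / 2)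

theorem diffQuot_mul (α : ℝ) (f g : EuclideanSpace ℝ (Fin d) → ℝ)
    (z : EuclideanSpace ℝ (Fin d) × EuclideanSpace ℝ (Fin d)) :
    diffQuot α f z * diffQuot α g z =
      (f z.1 - f z.2) * (g z.1 - g z.2) / ‖z.1 - z.2‖ ^ ((d : ℝ) + α) := by
  rw [diffQuot, diffQuot, div_mul_div_comm, ← sq, ← Real.rpow_natCast,
    ← Real.rpow_mul (norm_nonneg _)]
  congr 2
  push_cast
  ring

theorem dirichletForm_eq (α : ℝ) (f g : EuclideanSpace ℝ (Fin d) → ℝ) :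
    dirichletForm α f g = fracConst d α / 2 * ∫ z, diffQuot α f z * diffQuot α g z := by
  simp_rw [diffQuot_mul]
  rfl

theorem measurable_diffQuot (α : ℝ) {f : EuclideanSpace ℝ (Fin d) → ℝ} (hf : Measurable f) :
    Measurable (diffQuot α f) := by
  unfold diffQuot
  fun_prop

theorem memLp_diffQuot {α : ℝ} (hα0 : 0 < α) (hα2 : α < 2) {f : EuclideanSpace ℝ (Fin d) → ℝ}
    (hf : Measurable f) (hE : energy α f < ∞) : MemLp (diffQuot α f) 2 := by
  have hc := fracConst_pos (d := d) hα0 hα2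
  rw [memLp_two_iff_integrable_sq (measurable_diffQuot α hf).aestronglyMeasurable]
  refine ⟨((measurable_diffQuot α hf).pow_const 2).aestronglyMeasurable, ?_⟩
  rw [hasFiniteIntegral_iff_ofReal (.of_forall fun _ => sq_nonneg _)]
  simp_rw [sq, diffQuot_mul, ← sq]
  exact ENNReal.lt_top_of_mul_ne_top_right hE.ne (by simp; positivity)

theorem measurable_zeroExt {D : Set (EuclideanSpace ℝ (Fin d))} (hD : IsOpen D) (u : L2 D) :
    Measurable (zeroExt u) :=
  (Lp.stronglyMeasurable u).measurable.indicator hD.measurableSet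

theorem memLp_zeroExt {D : Set (EuclideanSpace ℝ (Fin d))} (hD : IsOpen D) (u : L2 D) :
    MemLp (zeroExt u) 2 :=
  (memLp_indicator_iff_restrict hD.measurableSet).2 (Lp.memLp u)

theorem zeroExt_congr {D : Set (EuclideanSpace ℝ (Fin d))} (hD : IsOpen D) {u : L2 D}
    {f : EuclideanSpace ℝ (Fin d) → ℝ} (h : u =ᵐ[volume.restrict D] f) :
    zeroExt u =ᵐ[volume] D.indicator f := by
  have h' := (ae_restrict_iff' hD.measurableSet).1 h
  filter_upwards [h'] with x hx
  by_cases hxD : x ∈ D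
  · simp [zeroExt, hxD, hx hxD]
  · simp [zeroExt, hxD]

theorem zeroExt_sum_smul {D : Set (EuclideanSpace ℝ (Fin d))} (hD : IsOpen D) {m : ℕ}
    (c : Fin m → ℝ) (u : Fin m → L2 D) :
    zeroExt (∑ i, c i • u i) =ᵐ[volume] fun x => ∑ i, c i * zeroExt (u i) x := by
  have h : ∀ s : Finset (Fin m), zeroExt (∑ i ∈ s, c i • u i) =ᵐ[volume]
      fun x => ∑ i ∈ s, c i * zeroExt (u i) x := fun s => by
    induction s using Finset.induction_on with
    | empty =>
      simp only [Finset.sum_empty]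
      filter_upwards [zeroExt_congr hD (Lp.coeFn_zero ℝ 2 (volume.restrict D))] with x hx
      simpa using hx
    | insert a s ha ih =>
      rw [Finset.sum_insert ha]
      filter_upwards [zeroExt_congr hD (Lp.coeFn_add (c a • u a) (∑ i ∈ s, c i • u i)),
        zeroExt_congr hD (Lp.coeFn_smul (c a) (u a)), ih] with x h1 h2 h3
      rw [Finset.sum_insert ha, h1, ← h3, Set.indicator_add', Pi.add_apply]
      congr 1
      change zeroExt (c a • u a) x = _
      rw [h2]
      exact Set.indicator_const_smul_apply D (c a) (u a) x
  exact h Finset.univ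

theorem diffQuot_congr (α : ℝ) {f g : EuclideanSpace ℝ (Fin d) → ℝ} (h : f =ᵐ[volume] g) :
    diffQuot α f =ᵐ[volume] diffQuot α g := by
  have h1 := (Measure.quasiMeasurePreserving_fst (μ := (volume : Measure (EuclideanSpace ℝ (Fin d))))
    (ν := (volume : Measure (EuclideanSpace ℝ (Fin d))))).ae_eq_comp h
  have h2 := (Measure.quasiMeasurePreserving_snd (μ := (volume : Measure (EuclideanSpace ℝ (Fin d))))
    (ν := (volume : Measure (EuclideanSpace ℝ (Fin d))))).ae_eq_comp h
  rw [Measure.volume_eq_prod]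
  filter_upwards [h1, h2] with z hz1 hz2
  simp only [Function.comp_apply] at hz1 hz2
  simp only [diffQuot, hz1, hz2]

theorem diffQuot_zeroExt_sum_smul (α : ℝ) {D : Set (EuclideanSpace ℝ (Fin d))} (hD : IsOpen D)
    {m : ℕ} (c : Fin m → ℝ) (u : Fin m → L2 D) :
    diffQuot α (zeroExt (∑ i, c i • u i)) =ᵐ[volume]
      fun z => ∑ i, c i * diffQuot α (zeroExt (u i)) z := by
  filter_upwards [diffQuot_congr α (zeroExt_sum_smul hD c u)] with z hz
  rw [hz]
  simp only [diffQuot, ← Finset.sum_sub_distrib, Finset.sum_div, ← mul_sub, mul_div_assoc]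

theorem dirichletForm_sum_smul (α : ℝ) {D : Set (EuclideanSpace ℝ (Fin d))} (hD : IsOpen D)
    {m : ℕ} (c : Fin m → ℝ) (u : Fin m → L2 D)
    (hu : ∀ i, MemLp (diffQuot α (zeroExt (u i))) 2) :
    dirichletForm α (zeroExt (∑ i, c i • u i)) (zeroExt (∑ i, c i • u i)) =
      ∑ i, ∑ j, c i * c j * dirichletForm α (zeroExt (u i)) (zeroExt (u j)) := by
  have hi : ∀ i j, Integrable fun z =>
      c i * c j * (diffQuot α (zeroExt (u i)) z * diffQuot α (zeroExt (u j)) z) := fun i j =>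
    ((hu i).integrable_mul (hu j)).const_mul _
  have hs : ∫ z, diffQuot α (zeroExt (∑ i, c i • u i)) z * diffQuot α (zeroExt (∑ i, c i • u i)) z =
      ∑ i, ∑ j, c i * c j *
        ∫ z, diffQuot α (zeroExt (u i)) z * diffQuot α (zeroExt (u j)) z := by
    calc _ = ∫ z, ∑ i, ∑ j, c i * c j *
          (diffQuot α (zeroExt (u i)) z * diffQuot α (zeroExt (u j)) z) := by
          refine integral_congr_ae ?_
          filter_upwards [diffQuot_zeroExt_sum_smul α hD c u] with z hz
          rw [hz, Finset.sum_mul_sum]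
          exact Finset.sum_congr rfl fun i _ => Finset.sum_congr rfl fun j _ => by ring
      _ = _ := by
          rw [integral_finsetSum _ fun i _ => integrable_finsetSum _ fun j _ => hi i j]
          refine Finset.sum_congr rfl fun i _ => ?_
          rw [integral_finsetSum _ fun j _ => hi i j]
          simp_rw [integral_const_mul]
  simp_rw [dirichletForm_eq]
  rw [hs, Finset.mul_sum]
  refine Finset.sum_congr rfl fun i _ => ?_
  rw [Finset.mul_sum]
  exact Finset.sum_congr rfl fun j _ => by ring

theorem dirichletForm_comm (α : ℝ) (f g : EuclideanSpace ℝ (Fin d) → ℝ) :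
    dirichletForm α f g = dirichletForm α g f := by
  simp_rw [dirichletForm_eq, mul_comm (diffQuot α f _)]

/-! ### Eigenfunctions -/

/-- Eigenfunctions for different eigenvalues are orthogonal. -/
theorem inner_eq_zero_of_isFracLaplacian {α : ℝ} {D : Set (EuclideanSpace ℝ (Fin d))} {u v : L2 D}
    {μ ν : ℝ} (hu : IsFracLaplacian α D u (μ • u)) (hv : IsFracLaplacian α D v (ν • v))
    (hμν : μ ≠ ν) : inner ℝ u v = 0 := by
  have h1 := hu.2 v hv.1
  have h2 := hv.2 u hu.1
  rw [dirichletForm_comm, h1, real_inner_smul_left, real_inner_smul_left, real_inner_comm u v] at h2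
  exact (mul_eq_zero.1 (show (μ - ν) * inner ℝ u v = 0 by linarith)).resolve_left (sub_ne_zero.2 hμν)

/-- On the span of the eigenfunctions with eigenvalue at most `lam`, the energy is finite and at
most `lam ‖u‖²`. -/
theorem dirichletForm_le_of_mem_eigenSpan {α : ℝ} (hα0 : 0 < α) (hα2 : α < 2)
    {D : Set (EuclideanSpace ℝ (Fin d))} (hD : IsOpen D) {lam : ℝ} {u : L2 D}
    (hu : u ∈ eigenSpan α D (Set.Iic lam)) :
    MemLp (diffQuot α (zeroExt u)) 2 ∧
      dirichletForm α (zeroExt u) (zeroExt u) ≤ lam * ‖u‖ ^ 2 := by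
  obtain ⟨m, c, g, rfl⟩ := Submodule.mem_span_set'.1 hu
  choose μ hμ hg using fun i => (g i).2
  have hmem : ∀ i, MemLp (diffQuot α (zeroExt (g i : L2 D))) 2 := fun i =>
    memLp_diffQuot hα0 hα2 (measurable_zeroExt hD _) (hg i).1.1
  refine ⟨(memLp_finsetSum _ fun i _ => (hmem i).const_mul (c i)).ae_eq
    (diffQuot_zeroExt_sum_smul α hD c fun i => (g i : L2 D)).symm, ?_⟩
  rw [dirichletForm_sum_smul α hD c (fun i => (g i : L2 D)) hmem, ← real_inner_self_eq_norm_sq,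
    ← sub_nonneg]
  -- By orthogonality `lam ‖u‖² - E(u, u)` is the square of a norm.
  have key : ∀ i j, Real.sqrt (lam - μ i) * Real.sqrt (lam - μ j) * inner ℝ (g i : L2 D) (g j) =
      (lam - μ i) * inner ℝ (g i : L2 D) (g j) := fun i j => by
    by_cases hij : μ i = μ j
    · rw [hij, Real.mul_self_sqrt (sub_nonneg.2 (hμ j))]
    · rw [inner_eq_zero_of_isFracLaplacian (hg i) (hg j) hij, mul_zero, mul_zero]
  have hsq := real_inner_self_nonneg (x := ∑ i, (c i * Real.sqrt (lam - μ i)) • (g i : L2 D))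
  simp_rw [sum_inner, inner_sum, real_inner_smul_left, real_inner_smul_right] at hsq ⊢
  refine hsq.trans_eq ?_
  rw [Finset.mul_sum, ← Finset.sum_sub_distrib]
  refine Finset.sum_congr rfl fun i _ => ?_
  rw [Finset.mul_sum, ← Finset.sum_sub_distrib]
  refine Finset.sum_congr rfl fun j _ => ?_
  rw [(hg i).2 _ (hg j).1, real_inner_smul_left]
  linear_combination c i * c j * key i j

/-! ### Functionals on `L²(D)` -/

theorem norm_sq_eq_integral_zeroExt {D : Set (EuclideanSpace ℝ (Fin d))} (hD : IsOpen D)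
    (u : L2 D) : ‖u‖ ^ 2 = ∫ x, zeroExt u x ^ 2 := by
  rw [← real_inner_self_eq_norm_sq, L2.inner_def, ← integral_indicator hD.measurableSet]
  congr 1
  ext x
  by_cases hx : x ∈ D <;> simp [zeroExt, hx, sq]

/-- The indicator function of a grid cube, as an element of `L²(D)`. -/
noncomputable def cellIndicator (D : Set (EuclideanSpace ℝ (Fin d))) {ε : ℝ} (hε : 0 < ε)
    (k : Fin d → ℤ) : L2 D :=
  indicatorConstLp 2 (measurableSet_preimage_cell ε k)
    (((Measure.restrict_apply_le D _).trans_lt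
      ((volume_preimage_cell hε k).trans_lt ENNReal.ofReal_lt_top)).ne) 1

theorem inner_cellIndicator {D : Set (EuclideanSpace ℝ (Fin d))} (hD : IsOpen D) {ε : ℝ}
    (hε : 0 < ε) (k : Fin d → ℤ) (u : L2 D) :
    inner ℝ (cellIndicator D hε k) u = cellIntegral ε (zeroExt u) k := by
  rw [cellIndicator, L2.inner_indicatorConstLp_one, cellIntegral,
    Measure.restrict_restrict (measurableSet_preimage_cell ε k)]
  exact (setIntegral_indicator hD.measurableSet).symm

end FracLap

/-! ### The comparison of eigenvalues -/

theorem mainTheorem6 {d : ℕ} (hd : 0 < d) (α : ℝ) (hα0 : 0 < α) (hα2 : α < 2)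
    (D : Set (EuclideanSpace ℝ (Fin d))) (hDo : IsOpen D) (hDb : Bornology.IsBounded D)
    (ε : ℝ) (hε : 0 < ε) (N : ℕ) (κ : Fin N ≃ FracLap.gridIndex D ε)
    (n : ℕ) (hn : 1 ≤ n) (lam : ℝ) (hlam : FracLap.IsNthEigenvalue α D n lam) :
    FracLap.lowerBound α D ε κ n ≤ lam := by
  open FracLap in
  set hV := gridMatrix_isHermitian α D ε κ
  set σ := Tuple.sort hV.eigenvalues
  -- The first `n - 1` eigenvectors of `V`, as step functions on the grid.
  let b : Fin (n - 1) → L2 D := fun i => if h : (i : ℕ) < N then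
    ∑ p, hV.eigenvectorBasis (σ ⟨i, h⟩) p • cellIndicator D hε (κ p) else 0
  have hrank : ((n - 1 : ℕ) : Cardinal) < Module.rank ℝ (eigenSpan α D (Set.Iic lam)) :=
    lt_of_lt_of_le (by exact_mod_cast Nat.sub_lt hn one_pos) hlam.2
  obtain ⟨u, hu, hu0, hub⟩ := exists_ne_zero_forall_inner_eq_zero _ hrank b
  obtain ⟨hmem, hle⟩ := dirichletForm_le_of_mem_eigenSpan hα0 hα2 hDo hu
  set f := zeroExt u
  have hf2 : MemLp f 2 := memLp_zeroExt hDo u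
  have hfD : ∀ x ∉ D, f x = 0 := fun x hx => Set.indicator_of_notMem hx _
  have hfi : Integrable fun z : EuclideanSpace ℝ (Fin d) × EuclideanSpace ℝ (Fin d) =>
      (f z.1 - f z.2) * (f z.1 - f z.2) / ‖z.1 - z.2‖ ^ ((d : ℝ) + α) := by
    simp_rw [← diffQuot_mul]
    exact hmem.integrable_mul hmem
  have hform := (le_dirichletForm_self hd hα0 hα2 hε κ hf2 hfD hfi).trans hle
  have hbessel := sum_cellIntegral_sq_le hε κ hf2 hfD
  have hquad := lowerBound_mul_le α D ε κ n (fun p => cellIntegral ε f (κ p)) fun i hi => by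
    have h := hub ⟨i, hi⟩
    simp only [b, dif_pos i.2, sum_inner, real_inner_smul_left, inner_cellIndicator hDo] at h
    exact h
  rw [sum_gridMatrix_mul] at hquad
  rw [← norm_sq_eq_integral_zeroExt hDo u] at hform hbessel
  have hε' : 0 < ε ^ d := pow_pos hε d
  have hC : fracConst d α / ε ^ α = fracConst d α * ε ^ (-((d : ℝ) + α)) * ε ^ d := by
    rw [mul_assoc, ← Real.rpow_natCast, ← Real.rpow_add hε, div_eq_mul_inv, ← Real.rpow_neg hε.le]
    congr 2
    ring
  have hM := lowerBound_le_nuBar α D ε κ n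
  have hu2 : 0 < ‖u‖ ^ 2 := by positivity
  rw [hC] at hquad hM
  set m := lowerBound α D ε κ n
  set C := fracConst d α * ε ^ (-((d : ℝ) + α))
  set S := ∑ p, ∑ q, gridWeight α ((κ p : Fin d → ℤ) - (κ q : Fin d → ℤ)) *
    (cellIntegral ε f (κ p) * cellIntegral ε f (κ q))
  set A := ∑ p, cellIntegral ε f (κ p) ^ 2
  -- The excess `‖u‖² - ε^{-d} A ≥ 0` carries the coefficient `C ε^d ν̄ ≥ m`.
  have h1 : ε ^ d * (C * S) ≤ ε ^ d * ((C * ε ^ d * nuBar d α - m) * ‖u‖ ^ 2) := by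
    have := mul_le_mul_of_nonneg_left hbessel (sub_nonneg.2 hM)
    linarith
  have h2 := le_of_mul_le_mul_left h1 hε'
  exact le_of_mul_le_mul_right (by linarith) hu2
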